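/- Let $\mathbb{D}$ be the open unit disc in $\mathbb{C}$, let $\sigma$ be normalized arc length on $\partial\mathbb{D}$, and let $1\le p<\infty$. Let $H^p$ be the space of analytic functions $f$ on $\mathbb{D}$ with $$\|f\|_{H^p}^p=\sup_{0<r<1}\frac1{2\pi}\int_0^{2\pi}|f(re^{i\theta})|^p\,d\theta<\infty,$$ and let $S_2^p$ be the space of analytic functions $f$ on $\mathbb{D}$ with $f''\in H^p$, normed by $\|f\|_{S_2^p}=|f(0)|+|f'(0)|+\|f''\|_{H^p}$. For an analytic function $u$ on $\mathbb{D}$ let $M_u f=uf$. Let $\psi$ be analytic on $\mathbb{D}$. Then the following are equivalent: (a) $M_\psi$ is a bounded operator from $S_2^p$ to $S_2^p$. (b) $\psi\in S_2^p$, and $M_{2\psi'}$ and $M_\psi$ are bounded operators from $H^p$ to $H^p$. (c) $\psi\in S_2^p$ and $$\sup_{a\in\mathbb{D}}\int_{\partial\mathbb{D}}\frac{1-|a|^2}{|1-\overline{a}w|^2}\,|2\psi'(w)|^p\,d\sigma(w)<\infty,\qquad \sup_{a\in\mathbb{D}}\int_{\partial\mathbb{D}}\frac{1-|a|^2}{|1-\overline{a}w|^2}\,|\psi(w)|^p\,d\sigma(w)<\infty,$$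 where on $\partial\mathbb{D}$ the symbols $\psi$ and $\psi'$ denote the radial limit functions $w\mapsto\lim_{r\to1^-}\psi(rw)$ and $w\mapsto\lim_{r\to1^-}\psi'(rw)$, which exist $\sigma$-almost everywhere when $\psi\in S_2^p$. -/

import Mathlib

open scoped ENNReal Topology

noncomputable section

namespace HardyMult

/-- The open unit disc. Functions on the disc are represented by functions `ℂ → ℂ`; every notion
below depends only on their values on the disc. -/
def disc : Set ℂ := Metric.ball (0 : ℂ) 1

/-- The mean `(1 / 2π) ∫_0^{2π} g (r e^{iθ}) dθ` of a `[0, ∞]`-valued function on the circle of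
radius `r`. For `r = 1` it is the integral against normalized arc length on the unit circle. -/
def circleMean (g : ℂ → ℝ≥0∞) (r : ℝ) : ℝ≥0∞ :=
  (ENNReal.ofReal (2 * Real.pi))⁻¹ *
    ∫⁻ θ in Set.Ioc (0 : ℝ) (2 * Real.pi), g (circleMap 0 r θ)

/-- `sup_{0 < r < 1} (1 / 2π) ∫_0^{2π} |f (r e^{iθ})|^p dθ`, the `p`-th power of the Hardy norm,
with values in `[0, ∞]`. -/
def hardySup (p : ℝ) (f : ℂ → ℂ) : ℝ≥0∞ :=
  ⨆ r ∈ Set.Ioo (0 : ℝ) 1, circleMean (fun z => ‖f z‖ₑ ^ p) r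

/-- The Hardy space `H^p`. -/
def Hardy (p : ℝ) : Set (ℂ → ℂ) :=
  {f | DifferentiableOn ℂ f disc ∧ hardySup p f < ∞}

/-- The norm of `H^p` (meaningful on `Hardy p`). -/
def hardyNorm (p : ℝ) (f : ℂ → ℂ) : ℝ := (hardySup p f).toReal ^ (1 / p)

/-- The space `S_2^p` of analytic functions on the disc with second derivative in `H^p`. -/
def S2 (p : ℝ) : Set (ℂ → ℂ) :=
  {f | DifferentiableOn ℂ f disc ∧ deriv (deriv f) ∈ Hardy p}

/-- The norm `|f(0)| + |f'(0)| + ‖f''‖_{H^p}` of `S_2^p` (meaningful on `S2 p`). -/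
def S2Norm (p : ℝ) (f : ℂ → ℂ) : ℝ :=
  ‖f 0‖ + ‖deriv f 0‖ + hardyNorm p (deriv (deriv f))

/-- The multiplication operator `M_ψ`. -/
def mulOp (ψ : ℂ → ℂ) (f : ℂ → ℂ) : ℂ → ℂ := fun z => ψ z * f z

/-- `T` is a bounded operator from the space `X` with norm `N` into itself. -/
def IsBoundedOp (X : Set (ℂ → ℂ)) (N : (ℂ → ℂ) → ℝ) (T : (ℂ → ℂ) → ℂ → ℂ) : Prop :=
  (∀ f ∈ X, T f ∈ X) ∧ ∃ C : ℝ, ∀ f ∈ X, N (T f) ≤ C * N f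

/-- The boundary function `w ↦ lim_{r → 1⁻} f (r w)`, `|w| = 1` (radial limits). -/
def boundaryValue (f : ℂ → ℂ) (w : ℂ) : ℂ :=
  Filter.limUnder (𝓝[<] (1 : ℝ)) fun r : ℝ => f ((r : ℂ) * w)

/-- `sup_{a ∈ 𝔻} ∫_{∂𝔻} (1 - |a|²) / |1 - conj a * w|² |f(w)|^p dσ(w)`, where `f` on the circle
means the boundary function. -/
def poissonSup (p : ℝ) (f : ℂ → ℂ) : ℝ≥0∞ :=
  ⨆ a ∈ disc, circleMean (fun w =>
    ENNReal.ofReal ((1 - ‖a‖ ^ 2) / ‖1 - (starRingEnd ℂ) a * w‖ ^ 2) *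
      ‖boundaryValue f w‖ₑ ^ p) 1

end HardyMult

end

noncomputable section

namespace HardyMult

open MeasureTheory Set Filter

/-! All three conditions are equivalent to `ψ ∈ S2 p`. Testing (a) on the constant 1 gives this
membership, and (b) and (c) contain it. Conversely, if `g'` lies in `H^p`, hence in `H^1`, then `g`
is bounded: its oscillation on each circle is at most the integral of `|g'|`, and the maximum
principle compares the circle with the centre (`norm_le_of_deriv_mem_Hardy`). Applied to `ψ'` and
then to `ψ`, this bounds both functions. So both multipliers act boundedly on `H^p`, both Poisson
suprema are finite because the kernel has mean one, and the Leibniz rule for `(ψf)''` gives (a). -/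

/-- Normalized Lebesgue measure on the parameter interval `(0, 2π]` of the circle. -/
def circleMeasure : Measure ℝ :=
  (ENNReal.ofReal (2 * Real.pi))⁻¹ • volume.restrict (Ioc (0 : ℝ) (2 * Real.pi))

instance : IsProbabilityMeasure circleMeasure := by
  refine ⟨?_⟩
  have h : ENNReal.ofReal (2 * Real.pi) ≠ 0 := by
    simpa using Real.pi_pos
  simp only [circleMeasure, Measure.smul_apply, Measure.restrict_apply MeasurableSet.univ,
    univ_inter, Real.volume_Ioc, sub_zero, smul_eq_mul]
  exact ENNReal.inv_mul_cancel h ENNReal.ofReal_ne_top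

/-! ### Circular means as `L^p` seminorms -/

lemma circleMean_eq_lintegral (g : ℂ → ℝ≥0∞) (r : ℝ) :
    circleMean g r = ∫⁻ θ, g (circleMap 0 r θ) ∂circleMeasure := by
  simp [circleMean, circleMeasure, lintegral_smul_measure]

lemma isOpen_disc : IsOpen disc := Metric.isOpen_ball

lemma mem_disc {z : ℂ} : z ∈ disc ↔ ‖z‖ < 1 := by simp [disc]

lemma circleMap_mem_disc {r : ℝ} (hr : r ∈ Ioo (0 : ℝ) 1) (θ : ℝ) : circleMap 0 r θ ∈ disc := by
  simp [mem_disc, abs_of_pos hr.1, hr.2]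

lemma continuous_comp_circleMap {f : ℂ → ℂ} (hf : ContinuousOn f disc) {r : ℝ}
    (hr : r ∈ Ioo (0 : ℝ) 1) : Continuous fun θ => f (circleMap 0 r θ) :=
  hf.comp_continuous (continuous_circleMap 0 r) (circleMap_mem_disc hr)

lemma aestronglyMeasurable_comp_circleMap {f : ℂ → ℂ} (hf : DifferentiableOn ℂ f disc) {r : ℝ}
    (hr : r ∈ Ioo (0 : ℝ) 1) :
    AEStronglyMeasurable (fun θ => f (circleMap 0 r θ)) circleMeasure :=
  (continuous_comp_circleMap hf.continuousOn hr).aestronglyMeasurable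

/-- Lets Minkowski's inequality and the comparison of exponents be quoted for circular means. -/
lemma eLpNorm_rpow_eq_circleMean {p : ℝ} (hp : 1 ≤ p) (f : ℂ → ℂ) (r : ℝ) :
    eLpNorm (fun θ => f (circleMap 0 r θ)) (ENNReal.ofReal p) circleMeasure ^ p =
      circleMean (fun z => ‖f z‖ₑ ^ p) r := by
  have hp0 : 0 < p := by linarith
  rw [eLpNorm_eq_lintegral_rpow_enorm_toReal (by simpa using hp0) ENNReal.ofReal_ne_top,
    ENNReal.toReal_ofReal hp0.le, ← ENNReal.rpow_mul, one_div_mul_cancel hp0.ne',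
    ENNReal.rpow_one, circleMean_eq_lintegral]

lemma hardyNorm_nonneg (p : ℝ) (f : ℂ → ℂ) : 0 ≤ hardyNorm p f :=
  Real.rpow_nonneg ENNReal.toReal_nonneg _

lemma S2Norm_nonneg (p : ℝ) (f : ℂ → ℂ) : 0 ≤ S2Norm p f :=
  add_nonneg (by positivity) (hardyNorm_nonneg _ _)

/-- The circular means of an `H^p` function are bounded by its norm. -/
lemma eLpNorm_le_hardyNorm {p : ℝ} (hp : 1 ≤ p) {f : ℂ → ℂ} (hf : hardySup p f < ∞) {r : ℝ}
    (hr : r ∈ Ioo (0 : ℝ) 1) :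
    eLpNorm (fun θ => f (circleMap 0 r θ)) (ENNReal.ofReal p) circleMeasure ≤
      ENNReal.ofReal (hardyNorm p f) := by
  have hp0 : 0 < p := by linarith
  rw [← ENNReal.rpow_le_rpow_iff hp0, eLpNorm_rpow_eq_circleMean hp,
    ENNReal.ofReal_rpow_of_nonneg (hardyNorm_nonneg _ _) hp0.le, hardyNorm,
    ← Real.rpow_mul ENNReal.toReal_nonneg, one_div_mul_cancel hp0.ne', Real.rpow_one,
    ENNReal.ofReal_toReal hf.ne]
  exact le_iSup₂ (f := fun r _ => circleMean (fun z => ‖f z‖ₑ ^ p) r) r hr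

/-- A uniform bound on the circular means bounds the `H^p` norm. -/
lemma hardyNorm_le_of_eLpNorm_le {p : ℝ} (hp : 1 ≤ p) {f : ℂ → ℂ} {K : ℝ} (hK : 0 ≤ K)
    (h : ∀ r ∈ Ioo (0 : ℝ) 1,
      eLpNorm (fun θ => f (circleMap 0 r θ)) (ENNReal.ofReal p) circleMeasure ≤
        ENNReal.ofReal K) :
    hardySup p f < ∞ ∧ hardyNorm p f ≤ K := by
  have hp0 : 0 < p := by linarith
  have hs : hardySup p f ≤ ENNReal.ofReal (K ^ p) := by
    refine iSup₂_le fun r hr => ?_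
    rw [← eLpNorm_rpow_eq_circleMean hp, ← ENNReal.ofReal_rpow_of_nonneg hK hp0.le]
    exact ENNReal.rpow_le_rpow (h r hr) hp0.le
  refine ⟨hs.trans_lt ENNReal.ofReal_lt_top, ?_⟩
  calc hardyNorm p f ≤ (K ^ p) ^ (1 / p) :=
        Real.rpow_le_rpow ENNReal.toReal_nonneg
          (ENNReal.toReal_le_of_le_ofReal (by positivity) hs) (by positivity)
    _ = K := by rw [← Real.rpow_mul hK, mul_one_div_cancel hp0.ne', Real.rpow_one]

/-! ### Sums and bounded multipliers in `H^p` -/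

/-- Multiplication by a bounded analytic function preserves `H^p`. -/
lemma mul_mem_Hardy {p : ℝ} (hp : 1 ≤ p) {h f : ℂ → ℂ} {M : ℝ}
    (hh : DifferentiableOn ℂ h disc) (hM : ∀ z ∈ disc, ‖h z‖ ≤ M) (hf : f ∈ Hardy p) :
    mulOp h f ∈ Hardy p ∧ hardyNorm p (mulOp h f) ≤ M * hardyNorm p f := by
  have hM0 : 0 ≤ M := (norm_nonneg _).trans (hM 0 (by simp [mem_disc]))
  have key := hardyNorm_le_of_eLpNorm_le hp (f := mulOp h f)
    (mul_nonneg hM0 (hardyNorm_nonneg p f)) fun r hr => by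
      rw [ENNReal.ofReal_mul hM0]
      refine le_trans (eLpNorm_le_mul_eLpNorm_of_ae_le_mul
        (g := fun θ => f (circleMap 0 r θ)) (c := M) (Eventually.of_forall fun θ => ?_) _)
        (mul_le_mul_right (eLpNorm_le_hardyNorm hp hf.2 hr) _)
      rw [mulOp, norm_mul]
      exact mul_le_mul_of_nonneg_right (hM _ (circleMap_mem_disc hr θ)) (norm_nonneg _)
  exact ⟨⟨hh.mul hf.1, key.1⟩, key.2⟩

lemma isBoundedOp_mulOp_Hardy {p : ℝ} (hp : 1 ≤ p) {h : ℂ → ℂ} {M : ℝ}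
    (hh : DifferentiableOn ℂ h disc) (hM : ∀ z ∈ disc, ‖h z‖ ≤ M) :
    IsBoundedOp (Hardy p) (hardyNorm p) (mulOp h) :=
  ⟨fun _ hf => (mul_mem_Hardy hp hh hM hf).1, M, fun _ hf => (mul_mem_Hardy hp hh hM hf).2⟩

lemma add_mem_Hardy {p : ℝ} (hp : 1 ≤ p) {f g : ℂ → ℂ} (hf : f ∈ Hardy p) (hg : g ∈ Hardy p) :
    f + g ∈ Hardy p ∧ hardyNorm p (f + g) ≤ hardyNorm p f + hardyNorm p g := by
  have key := hardyNorm_le_of_eLpNorm_le hp (f := f + g)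
    (add_nonneg (hardyNorm_nonneg p f) (hardyNorm_nonneg p g)) fun r hr => by
      rw [ENNReal.ofReal_add (hardyNorm_nonneg p f) (hardyNorm_nonneg p g)]
      exact (eLpNorm_add_le (aestronglyMeasurable_comp_circleMap hf.1 hr)
        (aestronglyMeasurable_comp_circleMap hg.1 hr) (by simpa using hp)).trans
        (add_le_add (eLpNorm_le_hardyNorm hp hf.2 hr) (eLpNorm_le_hardyNorm hp hg.2 hr))
  exact ⟨⟨hf.1.add hg.1, key.1⟩, key.2⟩

lemma hardySup_congr {p : ℝ} {f g : ℂ → ℂ} (h : EqOn f g disc) :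
    hardySup p f = hardySup p g := by
  refine iSup_congr fun r => iSup_congr fun hr => ?_
  simp only [circleMean_eq_lintegral]
  exact lintegral_congr fun θ => by rw [h (circleMap_mem_disc hr θ)]

lemma hardyNorm_congr {p : ℝ} {f g : ℂ → ℂ} (h : EqOn f g disc) :
    hardyNorm p f = hardyNorm p g := by
  rw [hardyNorm, hardySup_congr h, hardyNorm]

lemma Hardy_congr {p : ℝ} {f g : ℂ → ℂ} (h : EqOn f g disc) (hg : g ∈ Hardy p) :
    f ∈ Hardy p :=
  ⟨hg.1.congr h, by rw [hardySup_congr h]; exact hg.2⟩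

/-- Bounded analytic functions belong to `H^p`. -/
lemma bounded_mem_Hardy {p : ℝ} (hp : 1 ≤ p) {f : ℂ → ℂ} {M : ℝ}
    (hf : DifferentiableOn ℂ f disc) (hM : ∀ z ∈ disc, ‖f z‖ ≤ M) :
    f ∈ Hardy p ∧ hardyNorm p f ≤ M := by
  have hM0 : 0 ≤ M := (norm_nonneg _).trans (hM 0 (by simp [mem_disc]))
  have key := hardyNorm_le_of_eLpNorm_le hp (f := f) hM0 fun r hr => by
    simpa using eLpNorm_le_of_ae_bound (μ := circleMeasure) (p := ENNReal.ofReal p)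
      (Eventually.of_forall fun θ => hM _ (circleMap_mem_disc hr θ))
  exact ⟨⟨hf, key.1⟩, key.2⟩

/-- The `L¹` circular means of an `H^p` function are bounded by its `H^p` norm. -/
lemma lintegral_enorm_circleMap_le {p : ℝ} (hp : 1 ≤ p) {f : ℂ → ℂ} (hf : f ∈ Hardy p) {r : ℝ}
    (hr : r ∈ Ioo (0 : ℝ) 1) :
    ∫⁻ θ in Ioc (0 : ℝ) (2 * Real.pi), ‖f (circleMap 0 r θ)‖ₑ ≤
      ENNReal.ofReal (2 * Real.pi * hardyNorm p f) := by
  have h : ENNReal.ofReal (2 * Real.pi) ≠ 0 := by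
    simpa using Real.pi_pos
  have h1 : (ENNReal.ofReal (2 * Real.pi))⁻¹ *
      ∫⁻ θ in Ioc (0 : ℝ) (2 * Real.pi), ‖f (circleMap 0 r θ)‖ₑ ≤
        ENNReal.ofReal (hardyNorm p f) := by
    -- On a probability space the `L^1` norm is at most the `L^p` norm.
    have h2 := (eLpNorm_le_eLpNorm_of_exponent_le (p := 1) (q := ENNReal.ofReal p)
      (by simpa using hp) (aestronglyMeasurable_comp_circleMap hf.1 hr)).trans
      (eLpNorm_le_hardyNorm hp hf.2 hr)
    rwa [eLpNorm_one_eq_lintegral_enorm, circleMeasure, lintegral_smul_measure,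
      smul_eq_mul] at h2
  rw [ENNReal.ofReal_mul Real.two_pi_pos.le]
  exact (ENNReal.inv_mul_le_iff h ENNReal.ofReal_ne_top).1 h1

lemma differentiableOn_deriv {g : ℂ → ℂ} (hg : DifferentiableOn ℂ g disc) :
    DifferentiableOn ℂ (deriv g) disc :=
  hg.deriv isOpen_disc

lemma hasDerivAt_of_mem_disc {g : ℂ → ℂ} (hg : DifferentiableOn ℂ g disc) {z : ℂ}
    (hz : z ∈ disc) : HasDerivAt g (deriv g z) z :=
  (hg.differentiableAt (isOpen_disc.mem_nhds hz)).hasDerivAt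

/-! ### Functions with derivative in `H^p`: boundedness and radial limits -/

/-- An analytic function whose derivative is in `H^p` has small oscillation on circles. -/
lemma norm_sub_circleMap_le {p : ℝ} (hp : 1 ≤ p) {g : ℂ → ℂ} (hg : DifferentiableOn ℂ g disc)
    (hg' : deriv g ∈ Hardy p) {r : ℝ} (hr : r ∈ Ioo (0 : ℝ) 1) {s t : ℝ}
    (hs : 0 ≤ s) (hst : s ≤ t) (ht : t ≤ 2 * Real.pi) :
    ‖g (circleMap 0 r t) - g (circleMap 0 r s)‖ ≤ 2 * Real.pi * hardyNorm p (deriv g) := by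
  have hd : ∀ θ : ℝ, HasDerivAt (fun θ => g (circleMap 0 r θ))
      (deriv g (circleMap 0 r θ) * (circleMap 0 r θ * Complex.I)) θ := fun θ =>
    (hasDerivAt_of_mem_disc hg (circleMap_mem_disc hr θ)).comp θ (hasDerivAt_circleMap 0 r θ)
  have hc : Continuous fun θ : ℝ => deriv g (circleMap 0 r θ) * (circleMap 0 r θ * Complex.I) :=
    (continuous_comp_circleMap hg'.1.continuousOn hr).mul
      ((continuous_circleMap 0 r).mul continuous_const)
  rw [← intervalIntegral.integral_eq_sub_of_hasDerivAt (fun θ _ => hd θ)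
    (hc.intervalIntegrable _ _), intervalIntegral.integral_of_le hst]
  have hK : 0 ≤ 2 * Real.pi * hardyNorm p (deriv g) :=
    mul_nonneg Real.two_pi_pos.le (hardyNorm_nonneg _ _)
  rw [← ENNReal.ofReal_le_ofReal_iff hK, ofReal_norm]
  refine (enorm_integral_le_lintegral_enorm _).trans
    (le_trans ?_ (lintegral_enorm_circleMap_le hp hg' hr))
  refine le_trans (lintegral_mono_set (Ioc_subset_Ioc hs ht)) (lintegral_mono fun θ => ?_)
  rw [enorm_le_iff_norm_le, norm_mul, norm_mul, Complex.norm_I, mul_one]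
  exact mul_le_of_le_one_right (norm_nonneg _) (mem_disc.1 (circleMap_mem_disc hr θ)).le

/-- An analytic function whose derivative is in `H^p` is bounded. -/
lemma norm_le_of_deriv_mem_Hardy {p : ℝ} (hp : 1 ≤ p) {g : ℂ → ℂ}
    (hg : DifferentiableOn ℂ g disc) (hg' : deriv g ∈ Hardy p) {z : ℂ} (hz : z ∈ disc) :
    ‖g z‖ ≤ ‖g 0‖ + 2 * Real.pi * hardyNorm p (deriv g) := by
  have hK : 0 ≤ 2 * Real.pi * hardyNorm p (deriv g) :=
    mul_nonneg Real.two_pi_pos.le (hardyNorm_nonneg _ _)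
  rcases eq_or_ne z 0 with rfl | hz0
  · linarith
  have hr : ‖z‖ ∈ Ioo (0 : ℝ) 1 := ⟨norm_pos_iff.2 hz0, mem_disc.1 hz⟩
  have hex : ∀ w : ℂ, ‖w‖ = ‖z‖ → ∃ t ∈ Icc (0 : ℝ) (2 * Real.pi), circleMap 0 ‖z‖ t = w := by
    intro w hw
    have : w ∈ circleMap 0 ‖z‖ '' Ioc 0 (2 * Real.pi) := by
      rw [image_circleMap_Ioc]; simp [hw]
    obtain ⟨t, ht, h⟩ := this
    exact ⟨t, Ioc_subset_Icc_self ht, h⟩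
  have hosc : ∀ w : ℂ, ‖w‖ = ‖z‖ → ‖g w - g z‖ ≤ 2 * Real.pi * hardyNorm p (deriv g) := by
    intro w hw
    obtain ⟨t, ht, rfl⟩ := hex w hw
    obtain ⟨s, hs, hsz⟩ := hex z rfl
    rw [← congrArg g hsz]
    rcases le_total s t with h | h
    · exact norm_sub_circleMap_le hp hg hg' hr hs.1 h ht.2
    · rw [norm_sub_rev]
      exact norm_sub_circleMap_le hp hg hg' hr ht.1 h hs.2
  have hsub : closure (Metric.ball (0 : ℂ) ‖z‖) ⊆ disc := by
    rw [closure_ball _ hr.1.ne']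
    exact Metric.closedBall_subset_ball hr.2
  have h0 : ‖g 0 - g z‖ ≤ 2 * Real.pi * hardyNorm p (deriv g) := by
    -- Maximum principle for `g - g z` on the disc of radius `‖z‖`, evaluated at the centre.
    refine Complex.norm_le_of_forall_mem_frontier_norm_le (f := fun w => g w - g z)
      (U := Metric.ball (0 : ℂ) ‖z‖) Metric.isBounded_ball ?_ (fun w hw => hosc w ?_)
      (subset_closure (Metric.mem_ball_self hr.1))
    · exact ((hg.sub_const _).mono hsub).diffContOnCl
    · rw [frontier_ball _ hr.1.ne'] at hw
      simpa using hw
  have := norm_sub_norm_le (g z) (g 0)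
  rw [norm_sub_rev] at this
  linarith

/-- If `g'` is in `H^p`, then `g` has radial limits almost everywhere. -/
lemma ae_exists_radial_limit {p : ℝ} (hp : 1 ≤ p) {g : ℂ → ℂ}
    (hg : DifferentiableOn ℂ g disc) (hg' : deriv g ∈ Hardy p) :
    ∀ᵐ θ ∂(volume.restrict (Ioc (0 : ℝ) (2 * Real.pi))),
      ∃ l, Tendsto (fun r : ℝ => g ((r : ℂ) * circleMap 0 1 θ)) (𝓝[<] 1) (𝓝 l) := by
  have hmap : ∀ r θ : ℝ, (r : ℂ) * circleMap 0 1 θ = circleMap 0 r θ := by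
    intro r θ; simp [circleMap]
  have hcont : ContinuousOn (fun q : ℝ × ℝ => deriv g ((q.2 : ℂ) * circleMap 0 1 q.1))
      (Ioc (0 : ℝ) (2 * Real.pi) ×ˢ Ioo (0 : ℝ) 1) := by
    refine hg'.1.continuousOn.comp (Continuous.continuousOn ?_) fun q hq => ?_
    · fun_prop
    · rw [hmap]; exact circleMap_mem_disc hq.2 _
  have hmeas : AEMeasurable (fun q : ℝ × ℝ => ‖deriv g ((q.2 : ℂ) * circleMap 0 1 q.1)‖ₑ)
      ((volume.restrict (Ioc (0 : ℝ) (2 * Real.pi))).prod (volume.restrict (Ioo (0 : ℝ) 1))) := by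
    rw [Measure.prod_restrict]
    exact (hcont.aestronglyMeasurable (measurableSet_Ioc.prod measurableSet_Ioo)).enorm
  have hfin : ∫⁻ θ in Ioc (0 : ℝ) (2 * Real.pi), ∫⁻ r in Ioo (0 : ℝ) 1,
      ‖deriv g ((r : ℂ) * circleMap 0 1 θ)‖ₑ ≠ ∞ := by
    -- By Tonelli, the uniform `L^1` bound on circles makes `|g'|` integrable along almost every
    -- radius.
    rw [lintegral_lintegral_swap hmeas]
    refine ne_top_of_le_ne_top (b := ∫⁻ _ in Ioo (0 : ℝ) 1,
      ENNReal.ofReal (2 * Real.pi * hardyNorm p (deriv g))) ?_ ?_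
    · simp
    · refine setLIntegral_mono measurable_const fun r hr => ?_
      simp only [hmap]
      exact lintegral_enorm_circleMap_le hp hg' hr
  have hae := ae_lt_top' hmeas.lintegral_prod_right' hfin
  filter_upwards [hae] with θ hθ
  set w := circleMap 0 1 θ with hw
  -- Starting at -1 makes 0 an interior point, so the two-sided derivative exists there.
  have hmem : ∀ r ∈ Ioo (-1 : ℝ) 1, (r : ℂ) * w ∈ disc := by
    intro r hr
    simp [mem_disc, hw, abs_lt.2 hr]
  have hd : ∀ r ∈ Ioo (-1 : ℝ) 1, HasDerivAt (fun r : ℝ => g ((r : ℂ) * w))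
      (deriv g ((r : ℂ) * w) * w) r := by
    intro r hr
    have h1 : HasDerivAt (fun r : ℝ => (r : ℂ) * w) w r := by
      simpa using (Complex.ofRealCLM.hasDerivAt (x := r)).mul_const w
    exact (hasDerivAt_of_mem_disc hg (hmem r hr)).comp r h1
  have hc' : ContinuousOn (fun r : ℝ => deriv g ((r : ℂ) * w) * w) (Ioo (-1 : ℝ) 1) :=
    (hg'.1.continuousOn.comp (by fun_prop) hmem).mul continuousOn_const
  have hint : IntegrableOn (fun r : ℝ => deriv g ((r : ℂ) * w) * w) (uIcc 0 1) := by
    rw [uIcc_of_le zero_le_one, integrableOn_Icc_iff_integrableOn_Ioo]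
    refine Integrable.mul_const ⟨?_, hθ⟩ w
    refine ContinuousOn.aestronglyMeasurable ?_ measurableSet_Ioo
    exact hg'.1.continuousOn.comp (by fun_prop) fun r hr => hmem r ⟨by linarith [hr.1], hr.2⟩
  -- The primitive of an integrable function is continuous up to the endpoint 1; it equals `g (r w)
  -- - g 0` for `r < 1`.
  have hprim := intervalIntegral.continuousOn_primitive_interval hint 1 right_mem_uIcc
  rw [uIcc_of_le zero_le_one] at hprim
  have hlim := hprim.tendsto.mono_left (nhdsWithin_mono 1 (Ioo_subset_Icc_self (a := (0 : ℝ))))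
  rw [nhdsWithin_Ioo_eq_nhdsLT zero_lt_one] at hlim
  refine ⟨_, (hlim.const_add (g 0)).congr' ?_⟩
  filter_upwards [Ioo_mem_nhdsLT zero_lt_one] with r hr
  have hsub : uIcc 0 r ⊆ Ioo (-1 : ℝ) 1 := by
    rw [uIcc_of_le hr.1.le]
    exact fun x hx => ⟨by linarith [hx.1], hx.2.trans_lt hr.2⟩
  rw [intervalIntegral.integral_eq_sub_of_hasDerivAt (fun x hx => hd x (hsub hx))
    (hc'.mono hsub).intervalIntegrable]
  simp

/-! ### Poisson integrals of boundary values -/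

/-- The Poisson kernel has mean one on the unit circle. -/
lemma circleMean_poisson {a : ℂ} (ha : a ∈ disc) :
    circleMean (fun w => ENNReal.ofReal
      ((1 - ‖a‖ ^ 2) / ‖1 - (starRingEnd ℂ) a * w‖ ^ 2)) 1 = 1 := by
  have hker : ∀ w ∈ Metric.sphere (0 : ℂ) |1|, (1 - ‖a‖ ^ 2) / ‖1 - (starRingEnd ℂ) a * w‖ ^ 2 =
      poissonKernel 0 a w := by
    intro w hw
    have hw1 : ‖w‖ = 1 := by simpa using hw
    have h1 : ‖1 - (starRingEnd ℂ) a * w‖ = ‖w - a‖ := by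
      -- This uses `w * conj w = 1` on the unit circle.
      have : w * (starRingEnd ℂ) (w - a) = 1 - (starRingEnd ℂ) a * w := by
        have : w * (starRingEnd ℂ) w = 1 := by simp [Complex.mul_conj', hw1]
        rw [map_sub, mul_sub, this]; ring
      rw [← this, norm_mul, hw1, one_mul, RCLike.norm_conj]
    rw [h1, poissonKernel_def]
    simp [hw1]
  have hpos : ∀ w : ℂ, 0 ≤ (1 - ‖a‖ ^ 2) / ‖1 - (starRingEnd ℂ) a * w‖ ^ 2 := by
    intro w
    have := mem_disc.1 ha
    refine div_nonneg ?_ (by positivity)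
    nlinarith [norm_nonneg a]
  have hne : ∀ θ : ℝ, ‖1 - (starRingEnd ℂ) a * circleMap 0 1 θ‖ ^ 2 ≠ 0 := by
    intro θ
    refine pow_ne_zero 2 (norm_ne_zero_iff.2 fun h => ?_)
    have h2 := congrArg norm (sub_eq_zero.1 h)
    simp at h2
    linarith [mem_disc.1 ha]
  have hcont : Continuous fun θ : ℝ =>
      (1 - ‖a‖ ^ 2) / ‖1 - (starRingEnd ℂ) a * circleMap 0 1 θ‖ ^ 2 :=
    continuous_const.div (by fun_prop) hne
  have havg : Real.circleAverage
      (fun w => (1 - ‖a‖ ^ 2) / ‖1 - (starRingEnd ℂ) a * w‖ ^ 2) 0 1 = 1 := by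
    rw [Real.circleAverage_congr_sphere hker]
    have h := InnerProductSpace.HarmonicContOnCl.circleAverage_poissonKernel_smul (f := fun _ : ℂ => (1 : ℝ))
      (c := 0) (R := 1) (w := a) InnerProductSpace.harmonicContOnCl_const (by simpa [disc] using ha)
    have h1 : poissonKernel 0 a • (fun _ : ℂ => (1 : ℝ)) = poissonKernel 0 a := by
      ext w; simp
    rwa [h1] at h
  rw [Real.circleAverage_def, intervalIntegral.integral_of_le Real.two_pi_pos.le,
    smul_eq_mul] at havg
  rw [circleMean, ← ofReal_integral_eq_lintegral_ofReal
    ((hcont.integrableOn_Icc (a := 0) (b := 2 * Real.pi)).mono_set Ioc_subset_Icc_self)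
    (Eventually.of_forall fun θ => hpos _), ← ENNReal.ofReal_inv_of_pos Real.two_pi_pos,
    ← ENNReal.ofReal_mul (inv_nonneg.2 Real.two_pi_pos.le), havg, ENNReal.ofReal_one]

/-- The Poisson integrals of `|g|^p` are bounded when `g'` is in `H^p`. -/
lemma poissonSup_lt_top {p : ℝ} (hp : 1 ≤ p) {g : ℂ → ℂ}
    (hg : DifferentiableOn ℂ g disc) (hg' : deriv g ∈ Hardy p) : poissonSup p g < ∞ := by
  set M : ℝ := ‖g 0‖ + 2 * Real.pi * hardyNorm p (deriv g)
  have hbd : ∀ᵐ θ ∂circleMeasure, ‖boundaryValue g (circleMap 0 1 θ)‖ₑ ≤ ENNReal.ofReal M := by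
    refine Measure.ae_smul_measure ?_ _
    filter_upwards [ae_exists_radial_limit hp hg hg'] with θ hθ
    -- `limUnder` is meaningful only where the limit exists, which is almost everywhere.
    have hlim := tendsto_nhds_limUnder hθ
    refine (le_of_tendsto hlim.enorm ?_)
    filter_upwards [Ioo_mem_nhdsLT (zero_lt_one (α := ℝ))] with r hr
    rw [← ofReal_norm]
    refine ENNReal.ofReal_le_ofReal (norm_le_of_deriv_mem_Hardy hp hg hg' ?_)
    simp [mem_disc, abs_of_pos hr.1, hr.2]
  refine lt_of_le_of_lt (b := ENNReal.ofReal M ^ p) (iSup₂_le fun a ha => ?_)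
    (ENNReal.rpow_lt_top_of_nonneg (by linarith) ENNReal.ofReal_ne_top)
  calc _ ≤ ∫⁻ θ, ENNReal.ofReal
          ((1 - ‖a‖ ^ 2) / ‖1 - (starRingEnd ℂ) a * circleMap 0 1 θ‖ ^ 2) *
          ENNReal.ofReal M ^ p ∂circleMeasure := by
        rw [circleMean_eq_lintegral]
        refine lintegral_mono_ae ?_
        filter_upwards [hbd] with θ hθ
        gcongr
    _ = ENNReal.ofReal M ^ p := by
        rw [lintegral_mul_const' _ _
          (ENNReal.rpow_lt_top_of_nonneg (by linarith) ENNReal.ofReal_ne_top).ne,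
          ← circleMean_eq_lintegral (fun w => ENNReal.ofReal
            ((1 - ‖a‖ ^ 2) / ‖1 - (starRingEnd ℂ) a * w‖ ^ 2)),
          circleMean_poisson ha, one_mul]

/-! ### Sup-norm estimates and multiplication in `S_2^p` -/

lemma norm_deriv_le_S2Norm {p : ℝ} (hp : 1 ≤ p) {f : ℂ → ℂ} (hf : f ∈ S2 p) {z : ℂ}
    (hz : z ∈ disc) : ‖deriv f z‖ ≤ 2 * Real.pi * S2Norm p f := by
  have h := norm_le_of_deriv_mem_Hardy hp (differentiableOn_deriv hf.1) hf.2 hz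
  have h1 : (1 : ℝ) ≤ 2 * Real.pi := by linarith [Real.pi_gt_three]
  have h2 : ‖deriv f 0‖ ≤ 2 * Real.pi * ‖deriv f 0‖ :=
    le_mul_of_one_le_left (norm_nonneg _) h1
  have h3 : 0 ≤ 2 * Real.pi * ‖f 0‖ := by positivity
  rw [S2Norm, mul_add, mul_add]
  linarith

lemma deriv_mem_Hardy_of_mem_S2 {p : ℝ} (hp : 1 ≤ p) {f : ℂ → ℂ} (hf : f ∈ S2 p) :
    deriv f ∈ Hardy p ∧ hardyNorm p (deriv f) ≤ 2 * Real.pi * S2Norm p f :=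
  bounded_mem_Hardy hp (differentiableOn_deriv hf.1) fun _ hz => norm_deriv_le_S2Norm hp hf hz

lemma norm_le_S2Norm {p : ℝ} (hp : 1 ≤ p) {f : ℂ → ℂ} (hf : f ∈ S2 p) {z : ℂ}
    (hz : z ∈ disc) : ‖f z‖ ≤ (1 + (2 * Real.pi) ^ 2) * S2Norm p f := by
  have hd := deriv_mem_Hardy_of_mem_S2 hp hf
  have h := norm_le_of_deriv_mem_Hardy hp hf.1 hd.1 hz
  have h1 := mul_le_mul_of_nonneg_left hd.2 Real.two_pi_pos.le
  have h2 : ‖f 0‖ ≤ S2Norm p f := by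
    rw [S2Norm]; linarith [norm_nonneg (deriv f 0), hardyNorm_nonneg p (deriv (deriv f))]
  linarith

lemma deriv_mulOp {ψ f : ℂ → ℂ} (hψ : DifferentiableOn ℂ ψ disc) (hf : DifferentiableOn ℂ f disc)
    {z : ℂ} (hz : z ∈ disc) : deriv (mulOp ψ f) z = deriv ψ z * f z + ψ z * deriv f z :=
  ((hasDerivAt_of_mem_disc hψ hz).mul (hasDerivAt_of_mem_disc hf hz)).deriv

lemma deriv_deriv_mulOp {ψ f : ℂ → ℂ} (hψ : DifferentiableOn ℂ ψ disc)
    (hf : DifferentiableOn ℂ f disc) :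
    EqOn (deriv (deriv (mulOp ψ f)))
      (mulOp f (deriv (deriv ψ)) + mulOp (fun z => 2 * deriv ψ z) (deriv f) +
        mulOp ψ (deriv (deriv f))) disc := by
  intro z hz
  have hev : deriv (mulOp ψ f) =ᶠ[𝓝 z] mulOp (deriv ψ) f + mulOp ψ (deriv f) := by
    filter_upwards [isOpen_disc.mem_nhds hz] with x hx using deriv_mulOp hψ hf hx
  have h1 := (hasDerivAt_of_mem_disc (differentiableOn_deriv hψ) hz).mul
    (hasDerivAt_of_mem_disc hf hz)
  have h2 := (hasDerivAt_of_mem_disc hψ hz).mul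
    (hasDerivAt_of_mem_disc (differentiableOn_deriv hf) hz)
  rw [hev.deriv_eq]
  refine (h1.add h2).deriv.trans ?_
  simp only [mulOp, Pi.add_apply]
  ring

lemma norm_two_mul_deriv_le {p : ℝ} (hp : 1 ≤ p) {ψ : ℂ → ℂ} (hψ : ψ ∈ S2 p) {z : ℂ}
    (hz : z ∈ disc) : ‖2 * deriv ψ z‖ ≤ 2 * (2 * Real.pi * S2Norm p ψ) := by
  rw [norm_mul, Complex.norm_two]
  exact mul_le_mul_of_nonneg_left (norm_deriv_le_S2Norm hp hψ hz) zero_le_two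

/-- `S_2^p` is a Banach algebra up to a constant: its elements are multipliers of it. -/
lemma isBoundedOp_mulOp_S2 {p : ℝ} (hp : 1 ≤ p) {ψ : ℂ → ℂ} (hψ : ψ ∈ S2 p) :
    IsBoundedOp (S2 p) (S2Norm p) (mulOp ψ) := by
  set A : ℝ := 1 + (2 * Real.pi) ^ 2
  set B : ℝ := 2 * Real.pi
  have key : ∀ f ∈ S2 p, deriv (deriv (mulOp ψ f)) ∈ Hardy p ∧
      hardyNorm p (deriv (deriv (mulOp ψ f))) ≤
        A * S2Norm p f * hardyNorm p (deriv (deriv ψ)) +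
          2 * (B * S2Norm p ψ) * (B * S2Norm p f) +
          A * S2Norm p ψ * hardyNorm p (deriv (deriv f)) := by
    intro f hf
    have hd := deriv_mem_Hardy_of_mem_S2 hp hf
    -- The roles are swapped here: `f` is the bounded multiplier, and `ψ''` the element of `H^p`.
    have h1 := mul_mem_Hardy hp hf.1 (fun z hz => norm_le_S2Norm hp hf hz) hψ.2
    have h2 := mul_mem_Hardy hp ((differentiableOn_deriv hψ.1).const_mul 2)
      (fun z hz => norm_two_mul_deriv_le hp hψ hz) hd.1
    have h3 := mul_mem_Hardy hp hψ.1 (fun z hz => norm_le_S2Norm hp hψ hz) hf.2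
    have h12 := add_mem_Hardy hp h1.1 h2.1
    have h123 := add_mem_Hardy hp h12.1 h3.1
    have heq := deriv_deriv_mulOp hψ.1 hf.1
    refine ⟨Hardy_congr heq h123.1, ?_⟩
    rw [hardyNorm_congr heq]
    have h4 : 2 * (B * S2Norm p ψ) * hardyNorm p (deriv f) ≤
        2 * (B * S2Norm p ψ) * (B * S2Norm p f) :=
      mul_le_mul_of_nonneg_left hd.2
        (mul_nonneg zero_le_two (mul_nonneg Real.two_pi_pos.le (S2Norm_nonneg _ _)))
    linarith [h123.2, h12.2, h1.2, h2.2, h3.2]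
  refine ⟨fun f hf => ⟨hψ.1.mul hf.1, (key f hf).1⟩,
    -- The three groups control the value at 0, the derivative at 0 and the Hardy norm of the second
    -- derivative.
    ‖ψ 0‖ + (‖deriv ψ 0‖ + ‖ψ 0‖) + (A * hardyNorm p (deriv (deriv ψ)) +
      2 * (B * S2Norm p ψ) * B + A * S2Norm p ψ), fun f hf => ?_⟩
  have h0 : (0 : ℂ) ∈ disc := by simp [mem_disc]
  have hH := hardyNorm_nonneg p (deriv (deriv f))
  have hf0 : ‖f 0‖ ≤ S2Norm p f := by
    rw [S2Norm]; linarith [norm_nonneg (deriv f 0)]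
  have hf1 : ‖deriv f 0‖ ≤ S2Norm p f := by
    rw [S2Norm]; linarith [norm_nonneg (f 0)]
  have hf2 : hardyNorm p (deriv (deriv f)) ≤ S2Norm p f := by
    rw [S2Norm]; linarith [norm_nonneg (f 0), norm_nonneg (deriv f 0)]
  have e0 : ‖mulOp ψ f 0‖ ≤ ‖ψ 0‖ * S2Norm p f := by
    rw [mulOp, norm_mul]
    exact mul_le_mul_of_nonneg_left hf0 (norm_nonneg _)
  have e1 : ‖deriv (mulOp ψ f) 0‖ ≤ ‖deriv ψ 0‖ * S2Norm p f + ‖ψ 0‖ * S2Norm p f := by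
    rw [deriv_mulOp hψ.1 hf.1 h0]
    refine (norm_add_le _ _).trans (add_le_add ?_ ?_) <;> rw [norm_mul] <;> gcongr
  have e2 := (key f hf).2
  have e3 : A * S2Norm p ψ * hardyNorm p (deriv (deriv f)) ≤ A * S2Norm p ψ * S2Norm p f :=
    mul_le_mul_of_nonneg_left hf2 (mul_nonneg (by positivity) (S2Norm_nonneg _ _))
  rw [S2Norm]
  linarith

lemma one_mem_S2 {p : ℝ} (hp : 1 ≤ p) : (fun _ => 1 : ℂ → ℂ) ∈ S2 p := by
  refine ⟨differentiableOn_const 1, ?_⟩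
  have h : deriv (deriv (fun _ => 1 : ℂ → ℂ)) = fun _ => 0 := by
    ext z; simp
  rw [h]
  exact (bounded_mem_Hardy hp (M := 0) (differentiableOn_const 0) (by simp)).1

end HardyMult

end

/-! ### The equivalence -/

theorem mainTheorem4 (p : ℝ) (hp : 1 ≤ p) (ψ : ℂ → ℂ)
    (hψ : DifferentiableOn ℂ ψ HardyMult.disc) :
    List.TFAE [
      HardyMult.IsBoundedOp (HardyMult.S2 p) (HardyMult.S2Norm p) (HardyMult.mulOp ψ),
      ψ ∈ HardyMult.S2 p ∧
        HardyMult.IsBoundedOp (HardyMult.Hardy p) (HardyMult.hardyNorm p)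
          (HardyMult.mulOp (fun z => 2 * deriv ψ z)) ∧
        HardyMult.IsBoundedOp (HardyMult.Hardy p) (HardyMult.hardyNorm p) (HardyMult.mulOp ψ),
      ψ ∈ HardyMult.S2 p ∧
        HardyMult.poissonSup p (fun z => 2 * deriv ψ z) < ⊤ ∧
        HardyMult.poissonSup p ψ < ⊤] := by
  open HardyMult in
  have ha : IsBoundedOp (S2 p) (S2Norm p) (mulOp ψ) → ψ ∈ S2 p := fun h => by
    have h1 := h.1 _ (one_mem_S2 hp)
    have h2 : mulOp ψ (fun _ => 1) = ψ := by ext z; simp [mulOp]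
    rwa [h2] at h1
  tfae_have 1 → 2 := fun h =>
    ⟨ha h, HardyMult.isBoundedOp_mulOp_Hardy hp
        ((HardyMult.differentiableOn_deriv hψ).const_mul 2)
        (fun _ hz => HardyMult.norm_two_mul_deriv_le hp (ha h) hz),
      HardyMult.isBoundedOp_mulOp_Hardy hp hψ
        (fun _ hz => HardyMult.norm_le_S2Norm hp (ha h) hz)⟩
  -- Only `ψ ∈ S2 p` is used: the derivatives of `2ψ'` and of `ψ` are both in `H^p`.
  tfae_have 2 → 3 := fun h => by
    refine ⟨h.1, HardyMult.poissonSup_lt_top hp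
      ((HardyMult.differentiableOn_deriv hψ).const_mul 2) ?_,
      HardyMult.poissonSup_lt_top hp hψ (HardyMult.deriv_mem_Hardy_of_mem_S2 hp h.1).1⟩
    have h1 : deriv (fun z => 2 * deriv ψ z) =
        HardyMult.mulOp (fun _ => 2) (deriv (deriv ψ)) := by
      ext z; simp [HardyMult.mulOp, deriv_const_mul_field]
    rw [h1]
    exact (HardyMult.mul_mem_Hardy hp (M := 2) (differentiableOn_const 2) (by simp) h.1.2).1
  tfae_have 3 → 1 := fun h => HardyMult.isBoundedOp_mulOp_S2 hp h.1
  tfae_finish
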